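/- Let $q$ be a power of a prime $p>3$, and let $\mathcal M$ be the generalized Artin–Mumford curve over $\mathbb F_q$, that is, the projective closure of the (irreducible) affine plane curve $$(X^q-X)(Y^q-Y)=1 .$$ Let $\mathbb F_q(\mathcal M)=\mathbb F_q(x,y)$, with $(x^q-x)(y^q-y)=1$, be its function field, and let $\Sigma$ be the linear system of all conics passing through $O_1=(1:0:0)$ and $O_2=(0:1:0)$. The linear series cut out on $\mathcal M$ by $\Sigma$ has dimension $3$; its space of functions $V=\{H(x,y,1): H \text{ a quadratic form over } \mathbb F_q \text{ vanishing at } O_1 \text{ and } O_2\}$ has dimension $4$ over $\mathbb F_q$. For a basis $f_0,f_1,f_2,f_3$ of $V$, a separating variable $\tau$ of $\mathbb F_q(\mathcal M)/\mathbb F_q$ with Hasse derivatives $D_\tau^{(k)}$, and positive integers $u\ne m$ with $\gcd(u,m)=1$, the $(q^u,q^m)$-Frobenius order sequence of $\mathcal M$ with respect to $\Sigma$ is the lexicographically least sequence $(\kappa_0,\kappa_1)$ of non-negative integers for which $$\begin{vmatrix} f_0^{q^m} & f_1^{q^m} & f_2^{q^m} & f_3^{q^m}\\ f_0^{q^u}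 & f_1^{q^u} & f_2^{q^u} & f_3^{q^u}\\ D_\tau^{(\kappa_0)}f_0 & D_\tau^{(\kappa_0)}f_1 & D_\tau^{(\kappa_0)}f_2 & D_\tau^{(\kappa_0)}f_3\\ D_\tau^{(\kappa_1)}f_0 & D_\tau^{(\kappa_1)}f_1 & D_\tau^{(\kappa_1)}f_2 & D_\tau^{(\kappa_1)}f_3\end{vmatrix}\neq 0 ,$$ and $\mathcal M$ is called $(q^u,q^m)$-Frobenius classical with respect to $\Sigma$ if this sequence is $(0,1)$ (for every choice of the basis and of $\tau$). **Claim.** For all positive integers $u\neq m$ with $\gcd(u,m)=1$, the curve $\mathcal M$ is $(q^u,q^m)$-Frobenius classical with respect to $\Sigma$. -/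

import Mathlib

open Polynomial

noncomputable section

namespace FrobeniusOrders

/-! ### Hasse derivatives and Frobenius orders in a function field -/

section FunctionField

variable (F : Type*) [Field F] {K : Type*} [Field K] [Algebra F K]

/-- `τ` is a separating variable of `K / F`: the extension `K / F(τ)` is (algebraic and) separable.
When `K` is a function field of one variable over `F`, such a `τ` is automatically transcendental
over `F`. -/
def IsSeparatingVariable (τ : K) : Prop :=
  Algebra.IsSeparable (IntermediateField.adjoin F {τ}) K

/-- `D 0, D 1, D 2, …` is the family of Hasse derivatives with respect to `τ`: the maps are
`F`-linear, `D 0` is the identity, the family satisfies the Leibniz rule, and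
`D k (τ ^ j) = (j choose k) τ ^ (j - k)`.
For a separating variable `τ` there is exactly one such family. -/
structure IsHasseFamily (τ : K) (D : ℕ → K →ₗ[F] K) : Prop where
  zero_apply : ∀ g, D 0 g = g
  leibniz : ∀ k g h, D k (g * h) = ∑ ij ∈ Finset.HasAntidiagonal.antidiagonal k, D ij.1 g * D ij.2 h
  pow_apply : ∀ k j, D k (τ ^ j) = (j.choose k : K) * τ ^ (j - k)

open Classical in
/-- The `k`-th Hasse derivative `D_τ^{(k)} : K → K` with respect to `τ` (meaningful for a separating
variable `τ`; the zero map if `τ` admits no family of Hasse derivatives). -/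
def hasseDerivative (τ : K) (k : ℕ) : K →ₗ[F] K :=
  if h : ∃ D : ℕ → K →ₗ[F] K, IsHasseFamily F τ D then h.choose k else 0

/-- The matrix with rows `(f_j ^ {q ^ m})_j`, `(f_j ^ {q ^ u})_j` and `(D_τ^{(κ i)} f_j)_j`
for `i = 0, …, n - 1`, where `q = #F` and `f = (f_0, …, f_{n+1})`. -/
def frobeniusMatrix [Fintype F] (u m : ℕ) (τ : K) {n : ℕ} (f : Fin (n + 2) → K) (κ : Fin n → ℕ) :
    Matrix (Fin (n + 2)) (Fin (n + 2)) K :=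
  Matrix.of <| Matrix.vecCons (fun j => f j ^ (Fintype.card F ^ m)) <|
    Matrix.vecCons (fun j => f j ^ (Fintype.card F ^ u)) <|
      fun i j => hasseDerivative F τ (κ i) (f j)

/-- `κ` is the `(q ^ u, q ^ m)`-Frobenius order sequence computed from the functions `f` and the
variable `τ`: the lexicographically least sequence for which the determinant does not vanish. -/
def IsFrobeniusOrderSequence [Fintype F] (u m : ℕ) (τ : K) {n : ℕ} (f : Fin (n + 2) → K)
    (κ : Fin n → ℕ) : Prop :=
  IsLeast {s : Lex (Fin n → ℕ) | (frobeniusMatrix F u m τ f (ofLex s)).det ≠ 0} (toLex κ)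

/-- Let `V` be the space of functions attached to a linear series of dimension `r = n + 1`.
The series is `(q ^ u, q ^ m)`-Frobenius classical if its Frobenius order sequence
`(κ_0, …, κ_{r-2})` is `(0, 1, …, r - 2)`. The order sequence depends neither on the basis of `V`
nor on the separating variable, so it is required to be this one for all choices; that there are
choices to make (`V` has the dimension `r + 1 ≥ 2`, a separating variable exists) is required, so
that the condition is never vacuous. -/
def IsFrobeniusClassical [Fintype F] (V : Submodule F K) (u m : ℕ) : Prop :=
  ∃ n : ℕ, Module.finrank F V = n + 2 ∧
    (∃ τ : K, IsSeparatingVariable F τ) ∧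
    ∀ (f : Module.Basis (Fin (n + 2)) F V) (τ : K), IsSeparatingVariable F τ →
      IsFrobeniusOrderSequence F u m τ (fun j => (f j : K)) (fun i => (i : ℕ))

end FunctionField

/-! ### Plane curves and linear systems of conics -/

section PlaneCurve

variable {F : Type*} [Field F]

/-- The function field `F(𝓕) = Frac (F[X, Y] / (f))` of (the projective closure of) the affine plane
curve `f(X, Y) = 0`; here `F[X][Y]` is the ring of polynomials in `Y` over `F[X]`. -/
abbrev PlaneFunctionField (f : F[X][X]) : Type _ :=
  FractionRing (AdjoinRoot f)

/-- The coordinate function `x` of the curve `f(X, Y) = 0`. -/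
def xFun (f : F[X][X]) : PlaneFunctionField f :=
  algebraMap (AdjoinRoot f) _ (AdjoinRoot.of f X)

/-- The coordinate function `y` of the curve `f(X, Y) = 0`. -/
def yFun (f : F[X][X]) : PlaneFunctionField f :=
  algebraMap (AdjoinRoot f) _ (AdjoinRoot.root f)

variable (F) in
/-- The linear system of all (possibly reducible) conics in the projective plane passing through the
points with homogeneous coordinates `P` and `Q`, as the space of the quadratic forms in
`X = X 0`, `Y = X 1`, `Z = X 2` that vanish at `P` and `Q`. -/
def conicsThrough (P Q : Fin 3 → F) : Submodule F (MvPolynomial (Fin 3) F) :=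
  MvPolynomial.homogeneousSubmodule (Fin 3) F 2 ⊓
    (LinearMap.ker (MvPolynomial.aeval P : MvPolynomial (Fin 3) F →ₐ[F] F).toLinearMap ⊓
      LinearMap.ker (MvPolynomial.aeval Q : MvPolynomial (Fin 3) F →ₐ[F] F).toLinearMap)

/-- The space of functions attached to the linear series which a linear system `S` of plane curves
cuts out on the curve `f(X, Y) = 0`: the functions `H(x, y, 1)` with `H` in `S`, that is, the forms
of `S` modulo `f`, divided by a power of `Z`. Its elements `h` correspond to the divisors
`div h + E` of the series, with `E` fixed; removing the base locus `B` from the series replaces `E`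
by `E - B` and leaves the functions unchanged. -/
def seriesFunctions (f : F[X][X]) (S : Submodule F (MvPolynomial (Fin 3) F)) :
    Submodule F (PlaneFunctionField f) :=
  S.map (MvPolynomial.aeval ![xFun f, yFun f, 1] :
    MvPolynomial (Fin 3) F →ₐ[F] PlaneFunctionField f).toLinearMap

end PlaneCurve

/-! ### The generalized Artin-Mumford curve -/

section ArtinMumford

variable (F : Type*) [Field F] [Fintype F]

/-- The polynomial `(X ^ q - X) (Y ^ q - Y) - 1` with `q = #F`, which defines the generalized
Artin-Mumford curve over `F`. -/
def artinMumford : F[X][X] :=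
  C (X ^ Fintype.card F - X) * (X ^ Fintype.card F - X) - 1

/-- The polynomial is irreducible, so that the curve has a function field. -/
theorem irreducible_artinMumford : Irreducible (artinMumford F) := by
  classical
  obtain ⟨q, hq⟩ : ∃ q, Fintype.card F = q + 2 :=
    ⟨Fintype.card F - 2, by have := Fintype.one_lt_card (α := F); omega⟩
  rw [artinMumford, hq]
  set t : F[X] := X ^ (q + 2) - X with ht
  set f : F[X][X] := C t * (X ^ (q + 2) - X) - 1 with hf
  have ht0 : t ≠ 0 := by
    intro h
    have := congrArg (fun p => coeff p 1) h
    simp [ht, coeff_X_pow] at this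
  have hdeg : f.natDegree = q + 2 := by
    rw [hf]; compute_degree!
  have h0 : f.coeff 0 = -1 := by simp [hf]
  -- the reciprocal polynomial
  set g : F[X][X] := X ^ (q + 2) + C t * X ^ (q + 1) - C t with hg
  have hrev : f.reverse = -g := by
    have e : f = C t * X ^ (q + 2) + C (-t) * X ^ 1 + C (-1) * X ^ 0 := by
      rw [hf]; simp; ring
    rw [reverse, hdeg, e, reflect_add, reflect_add, reflect_C_mul_X_pow, reflect_C_mul_X_pow,
      reflect_C_mul_X_pow, revAt_le (by omega), revAt_le (by omega), revAt_le (by omega), hg]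
    simp
    ring
  have hgm : g.Monic := by
    rw [hg]; monicity!
  have hgd : g.natDegree = q + 2 := by
    rw [hg]; compute_degree!
  have htX : t ∈ Ideal.span {(X : F[X])} := by
    rw [Ideal.mem_span_singleton, X_dvd_iff]; simp [ht]
  have hgirr : Irreducible g := by
    refine irreducible_of_eisenstein_criterion (P := Ideal.span {(X : F[X])})
      ((Ideal.span_singleton_prime X_ne_zero).2 prime_X) ?_ ?_ ?_ ?_ hgm.isPrimitive
    · rw [hgm.leadingCoeff, Ideal.mem_span_singleton, X_dvd_iff]; simp
    · intro n hn
      rw [degree_eq_natDegree hgm.ne_zero, hgd] at hn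
      have hn' : n ≠ q + 2 := by
        rintro rfl; exact lt_irrefl _ hn
      simp only [hg, coeff_sub, coeff_add, coeff_X_pow, coeff_C_mul, coeff_C, if_neg hn', zero_add]
      refine Ideal.sub_mem _ (Ideal.mul_mem_right _ _ htX) ?_
      split_ifs
      · exact htX
      · exact Ideal.zero_mem _
    · rw [← natDegree_pos_iff_degree_pos, hgd]; omega
    · have : g.coeff 0 = -t := by simp [hg, coeff_X_pow]
      rw [this, Ideal.span_singleton_pow, Ideal.mem_span_singleton, X_pow_dvd_iff]
      intro h
      have := h 1 (by omega)
      simp [ht, coeff_X_pow] at this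
  have key : ∀ a b : F[X][X], f = a * b → IsUnit a.reverse → IsUnit a := by
    intro a b hab hu
    have ha0 : a.coeff 0 ≠ 0 := by
      intro h
      rw [hab, mul_coeff_zero, h] at h0
      simp at h0
    have hd : a.natDegree = 0 := by
      have h1 := reverse_natDegree a
      rw [natDegree_eq_zero_of_isUnit hu, natTrailingDegree_eq_zero_of_constantCoeff_ne_zero ha0]
        at h1
      omega
    rw [eq_C_of_natDegree_eq_zero hd] at hu ⊢
    rwa [reverse_C] at hu
  refine ⟨fun hu => ?_, fun a b hab => ?_⟩
  · have := natDegree_eq_zero_of_isUnit hu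
    omega
  · have h := hgirr.isUnit_or_isUnit (a := -a.reverse) (b := b.reverse) (by
      have h2 := reverse_mul_of_domain a b
      rw [← hab, hrev] at h2
      linear_combination -h2)
    rcases h with h | h
    · exact Or.inl (key a b hab ((IsUnit.neg_iff _).1 h))
    · exact Or.inr (key b a (by rw [hab, mul_comm]) h)

instance : IsDomain (AdjoinRoot (artinMumford F)) :=
  AdjoinRoot.isDomain_of_prime (irreducible_artinMumford F).prime

end ArtinMumford

end FrobeniusOrders

end

open Polynomial

noncomputable section

namespace FrobeniusOrders

/-! ### Existence of Hasse derivatives with respect to a separating variable -/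

/-! Only the monomials `Z²`, `XZ`, `YZ`, `XY` survive the conditions at the two points, so `V` is
spanned by `1, x, y, xy`. Any sequence below `(0, 1)` is `(0, 0)`, which repeats a row; it therefore
suffices that the determinant for `(0, 1)` is nonzero on these four functions, which also makes them
independent, and a change of basis carries this to every basis of `V`.

By `det_segre` that determinant involves only `x^(q^n) - x`, `y^(q^n) - y` for `n = u, m`, and `Dx`,
`Dy`. Put `t = x^q - x`, so `y^q - y = 1/t`. Telescoping gives `x^(q^n) - x = ∑_{i<n} t^(q^i)`, and
the same for `y` with `1/t`; differentiating the equation of the curve gives `Dx = -t² Dy`, where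
`Dy ≠ 0`. If the determinant vanished, dividing by `Dy` would leave an identity in the
transcendental `t`. For `u < m` its two sides have `t`-adic valuations `2 - q^(m-1)` and `2 -
q^(m-1) + q^u - q^(u-1)`, which differ (`truncated_trace_ne`).

Hasse derivatives must first be shown to exist: they are the coefficients of a Taylor expansion `K →
K⟦X⟧` lifted by formal smoothness. -/

/-- Lifting along a formally smooth algebra `A → K` into an adically complete ring `S`, where the
`A`-algebra structure of `S` is given by a ring homomorphism `φ`. -/
theorem exists_section_of_formallySmooth {A K S : Type*} [CommRing A] [CommRing K] [CommRing S]
    [Algebra A K] [Algebra.FormallySmooth A K] {I : Ideal S} [IsAdicComplete I S]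
    (φ : A →+* S) (π : S →+* K) (hπ : Function.Surjective π) (hI : RingHom.ker π = I)
    (hφ : ∀ a, π (φ a) = algebraMap A K a) :
    ∃ ψ : K →+* S, (∀ a, ψ (algebraMap A K a) = φ a) ∧ ∀ g, π (ψ g) = g := by
  subst hI
  let := φ.toAlgebra
  let π' : S →ₐ[A] K := { π with commutes' := hφ }
  let e : (S ⧸ RingHom.ker π) ≃ₐ[A] K :=
    Ideal.quotientKerAlgEquivOfSurjective (f := π') hπ
  obtain ⟨g, hg⟩ := Algebra.FormallySmooth.exists_mkₐ_comp_eq_of_isAdicComplete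
    (I := RingHom.ker π) e.symm.toAlgHom
  refine ⟨g.toRingHom, fun a => g.commutes a, fun z => ?_⟩
  have h1 : Ideal.Quotient.mk (RingHom.ker π) (g z) = e.symm z := DFunLike.congr_fun hg z
  have h2 : e (Ideal.Quotient.mk (RingHom.ker π) (g z)) = π (g z) := rfl
  rw [h1, AlgEquiv.apply_symm_apply] at h2
  exact h2.symm

section Hasse

variable {F K : Type*} [Field F] [Field K] [Algebra F K] {τ : K}

-- The base is `F[τ]` and not `F(τ)` because for transcendental `τ` it is a polynomial ring, on
-- which `τ ↦ τ + X` can be prescribed freely.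
open scoped IntermediateField.algebraAdjoinAdjoin in
theorem formallySmooth_adjoin (hτ : IsSeparatingVariable F τ) :
    Algebra.FormallySmooth (Algebra.adjoin F {τ}) K := by
  have : Algebra.IsSeparable (IntermediateField.adjoin F {τ}) K := hτ
  have : Algebra.FormallyEtale (IntermediateField.adjoin F {τ}) K :=
    Algebra.FormallyEtale.of_isSeparable _ _
  have : Algebra.FormallySmooth (Algebra.adjoin F {τ}) (IntermediateField.adjoin F {τ}) :=
    Algebra.FormallySmooth.of_isLocalization (nonZeroDivisors (Algebra.adjoin F {τ}))
  exact Algebra.FormallySmooth.comp _ (IntermediateField.adjoin F {τ}) _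

/-- The Taylor expansion `K → K⟦X⟧` with respect to a separating variable. -/
theorem exists_taylor_expansion (hτ : IsSeparatingVariable F τ) (htr : Transcendental F τ) :
    ∃ ψ : K →ₐ[F] PowerSeries K, ψ τ = PowerSeries.C τ + PowerSeries.X ∧
      ∀ g, PowerSeries.constantCoeff (ψ g) = g := by
  have := formallySmooth_adjoin hτ
  let e := Polynomial.algEquivOfTranscendental F τ htr
  let ρ : F[X] →ₐ[F] PowerSeries K := aeval (PowerSeries.C τ + PowerSeries.X)
  let φ : Algebra.adjoin F {τ} →ₐ[F] PowerSeries K := ρ.comp e.symm.toAlgHom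
  have hker : RingHom.ker (PowerSeries.constantCoeff (R := K)) =
      Ideal.span {(PowerSeries.X : PowerSeries K)} := by
    ext g
    rw [RingHom.mem_ker, Ideal.mem_span_singleton, PowerSeries.X_dvd_iff]
  have hρ : ∀ p : F[X], PowerSeries.constantCoeff (ρ p) = aeval τ p := by
    intro p
    have : PowerSeries.constantCoeff (ρ p) =
        eval₂ ((PowerSeries.constantCoeff (R := K)).comp (algebraMap F _))
          (PowerSeries.constantCoeff (PowerSeries.C τ + PowerSeries.X)) p :=
      Polynomial.hom_eval₂ _ _ _ _
    rw [this, aeval_def]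
    congr 1
    simp
  obtain ⟨ψ, h1, h2⟩ := exists_section_of_formallySmooth (A := Algebra.adjoin F {τ}) (K := K)
    φ.toRingHom PowerSeries.constantCoeff PowerSeries.constantCoeff_surj hker (fun a => by
      obtain ⟨p, rfl⟩ := e.surjective a
      have : φ (e p) = ρ p := by simp [φ]
      change PowerSeries.constantCoeff (φ (e p)) = _
      rw [this, hρ]
      simp [e])
  refine ⟨{ ψ with commutes' := fun c => ?_ }, ?_, h2⟩
  · have := h1 (algebraMap F _ c)
    rw [← IsScalarTower.algebraMap_apply] at this
    exact this.trans (φ.commutes c)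
  · have := h1 (e X)
    have h3 : φ (e X) = ρ X := by simp [φ]
    have h4 : algebraMap (Algebra.adjoin F {τ}) K (e X) = τ := by
      simp [e]
    rw [h4] at this
    refine this.trans (h3.trans ?_)
    simp [ρ]

/-- Take the coefficients of the Taylor expansion: its multiplicativity is the Leibniz rule, and the
binomial theorem for `(τ + X)^j` gives the values on powers. -/
theorem exists_isHasseFamily (hτ : IsSeparatingVariable F τ) (htr : Transcendental F τ) :
    ∃ D : ℕ → K →ₗ[F] K, IsHasseFamily F τ D := by
  obtain ⟨ψ, h1, h2⟩ := exists_taylor_expansion hτ htr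
  refine ⟨fun k => ((PowerSeries.coeff (R := K) k).restrictScalars F).comp ψ.toLinearMap,
    fun g => ?_, fun k g h => ?_, fun k j => ?_⟩
  · simpa using h2 g
  · simp [PowerSeries.coeff_mul]
  · have : (PowerSeries.C τ + PowerSeries.X : PowerSeries K) ^ j =
        (((Polynomial.X + Polynomial.C τ : K[X]) ^ j : K[X]) : PowerSeries K) := by
      simp [add_comm]
    simp only [LinearMap.comp_apply, AlgHom.toLinearMap_apply, map_pow, h1, this,
      LinearMap.restrictScalars_apply, Polynomial.coeff_coe, Polynomial.coeff_X_add_C_pow]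
    ring

/-- Excludes the default value `0` of `hasseDerivative`. The choice of family is harmless, since
only the defining properties are used. -/
theorem isHasseFamily_hasseDerivative (hτ : IsSeparatingVariable F τ)
    (htr : Transcendental F τ) : IsHasseFamily F τ (hasseDerivative F τ) := by
  have h := exists_isHasseFamily hτ htr
  have : hasseDerivative F τ = h.choose := by
    funext k
    simp [hasseDerivative, dif_pos h]
  rw [this]
  exact h.choose_spec

/-- The first Hasse derivative as a derivation. -/
def IsHasseFamily.derivation {D : ℕ → K →ₗ[F] K} (h : IsHasseFamily F τ D) : Derivation F K K :=
  Derivation.mk' (D 1) fun a b => by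
    rw [h.leibniz, Finset.Nat.sum_antidiagonal_eq_sum_range_succ fun i j => D i a * D j b]
    simp only [Finset.sum_range_succ, Finset.range_zero, Finset.sum_empty, h.zero_apply,
      smul_eq_mul, Nat.sub_zero, Nat.sub_self]
    ring

theorem IsHasseFamily.derivation_self {D : ℕ → K →ₗ[F] K} (h : IsHasseFamily F τ D) :
    h.derivation τ = 1 := by
  have : D 1 τ = 1 := by simpa using h.pow_apply 1 1
  exact this

end Hasse

/-! ### Truncated traces of a transcendental element -/

/-- The identity expressing the degeneracy of the Frobenius determinant fails for the truncated
traces of a transcendental element `t` and its inverse, as `t`-adic valuations show. -/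
theorem truncated_trace_ne_of_lt {F K : Type*} [Field F] [Field K] [Algebra F K] {t : K}
    (ht : Transcendental F t) {q : ℕ} (hq : 2 ≤ q) {u m : ℕ} (hu : 0 < u) (hum : u < m) :
    (∑ i ∈ Finset.range m, t ^ q ^ i) * (∑ i ∈ Finset.range u, t ^ q ^ i) *
        ((∑ i ∈ Finset.range m, t⁻¹ ^ q ^ i) - ∑ i ∈ Finset.range u, t⁻¹ ^ q ^ i) ≠
      t ^ 2 * (∑ i ∈ Finset.range m, t⁻¹ ^ q ^ i) * (∑ i ∈ Finset.range u, t⁻¹ ^ q ^ i) *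
        ((∑ i ∈ Finset.range u, t ^ q ^ i) - ∑ i ∈ Finset.range m, t ^ q ^ i) := by
  intro h
  have ht0 : t ≠ 0 := by rintro rfl; exact ht isAlgebraic_zero
  have hmono : StrictMono fun i => q ^ i := fun a b hab => Nat.pow_lt_pow_right (by omega) hab
  -- These are the sums with their lowest power of `t` removed: `t`, `t^(-q^(n-1))`, `t^(-q^(m-1))`
  -- and `t^(q^u)` respectively.
  let W : ℕ → F[X] := fun n => ∑ i ∈ Finset.range n, X ^ (q ^ i - 1)
  let R : ℕ → F[X] := fun n => ∑ i ∈ Finset.range n, X ^ (q ^ (n - 1) - q ^ i)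
  let Q : F[X] := ∑ i ∈ Finset.Ico u m, X ^ (q ^ (m - 1) - q ^ i)
  let Z : F[X] := ∑ i ∈ Finset.Ico u m, X ^ (q ^ i - q ^ u)
  have hW : ∀ n, ∑ i ∈ Finset.range n, t ^ q ^ i = t * aeval t (W n) := by
    intro n
    simp only [W, map_sum, map_pow, aeval_X, Finset.mul_sum]
    refine Finset.sum_congr rfl fun i _ => ?_
    have : 0 < q ^ i := by positivity
    rw [← pow_succ']
    congr 1; omega
  have hpow : ∀ a b : ℕ, b ≤ a → t⁻¹ ^ b = t⁻¹ ^ a * t ^ (a - b) := by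
    intro a b hab
    obtain ⟨c, rfl⟩ := Nat.exists_eq_add_of_le hab
    rw [Nat.add_sub_cancel_left, pow_add, mul_assoc, ← mul_pow, inv_mul_cancel₀ ht0, one_pow,
      mul_one]
  have hR : ∀ n, ∑ i ∈ Finset.range n, t⁻¹ ^ q ^ i = t⁻¹ ^ q ^ (n - 1) * aeval t (R n) := by
    intro n
    simp only [R, map_sum, map_pow, aeval_X, Finset.mul_sum]
    refine Finset.sum_congr rfl fun i hi => hpow _ _ (hmono.monotone ?_)
    have := Finset.mem_range.1 hi
    omega
  have hQ : (∑ i ∈ Finset.range m, t⁻¹ ^ q ^ i) - ∑ i ∈ Finset.range u, t⁻¹ ^ q ^ i =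
      t⁻¹ ^ q ^ (m - 1) * aeval t Q := by
    rw [← Finset.sum_Ico_eq_sub _ hum.le]
    simp only [Q, map_sum, map_pow, aeval_X, Finset.mul_sum]
    refine Finset.sum_congr rfl fun i hi => hpow _ _ (hmono.monotone ?_)
    have := Finset.mem_Ico.1 hi
    omega
  have hZ : (∑ i ∈ Finset.range u, t ^ q ^ i) - ∑ i ∈ Finset.range m, t ^ q ^ i =
      -(t ^ q ^ u * aeval t Z) := by
    rw [← neg_sub, ← Finset.sum_Ico_eq_sub _ hum.le]
    simp only [Z, map_sum, map_pow, aeval_X, Finset.mul_sum]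
    refine congrArg _ (Finset.sum_congr rfl fun i hi => ?_)
    rw [← pow_add, Nat.add_sub_cancel' (hmono.monotone (Finset.mem_Ico.1 hi).1)]
  -- `d` is the gap between the valuations of the two sides, whose common factor is `t²
  -- t^(-q^(m-1))`.
  obtain ⟨d, hd, hd0⟩ : ∃ d, q ^ u = q ^ (u - 1) + d ∧ d ≠ 0 := by
    have : q ^ (u - 1) < q ^ u := hmono (by omega : u - 1 < u)
    exact ⟨q ^ u - q ^ (u - 1), by omega, by omega⟩
  rw [hQ, hZ, hW, hW, hR, hR, hd] at h
  have key : aeval t (W m * W u * Q + R m * R u * X ^ d * Z) = 0 := by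
    simp only [map_add, map_mul, map_pow, aeval_X]
    have e : t⁻¹ ^ q ^ (u - 1) * t ^ (q ^ (u - 1) + d) = t ^ d := by
      rw [pow_add, ← mul_assoc, ← mul_pow, inv_mul_cancel₀ ht0, one_pow, one_mul]
    have hne : t ^ 2 * t⁻¹ ^ q ^ (m - 1) ≠ 0 := by positivity
    refine (mul_eq_zero.1 (?_ : t ^ 2 * t⁻¹ ^ q ^ (m - 1) * _ = 0)).resolve_left hne
    linear_combination h - t ^ 2 * t⁻¹ ^ q ^ (m - 1) * aeval t (R m) * aeval t (R u) *
      aeval t Z * e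
  -- Transcendence makes `key` a polynomial identity; its constant term reads `1 = 0`, as `W` and
  -- `Q` have constant term `1` and `d ≠ 0`.
  have h0 := congrArg (eval 0) ((transcendental_iff.1 ht) _ key)
  have hWe : ∀ n, 0 < n → eval 0 (W n) = 1 := by
    intro n hn
    simp only [W, eval_finsetSum, eval_pow, eval_X]
    rw [Finset.sum_eq_single_of_mem 0 (by simpa using hn)]
    · simp
    · intro i _ hi
      have : q ^ 0 < q ^ i := hmono (by omega : 0 < i)
      rw [pow_zero] at this
      rw [zero_pow]
      omega
  have hQe : eval 0 Q = 1 := by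
    simp only [Q, eval_finsetSum, eval_pow, eval_X]
    rw [Finset.sum_eq_single_of_mem (m - 1) (by simp; omega)]
    · simp
    · intro i hi him
      have := Finset.mem_Ico.1 hi
      have : q ^ i < q ^ (m - 1) := hmono (by omega)
      rw [zero_pow]
      omega
  simp [hWe m (by omega), hWe u hu, hQe, hd0] at h0

/-- Exchanging `u` and `m` negates both sides, so `u < m` may be assumed. -/
theorem truncated_trace_ne {F K : Type*} [Field F] [Field K] [Algebra F K] {t : K}
    (ht : Transcendental F t) {q : ℕ} (hq : 2 ≤ q) {u m : ℕ} (hu : 0 < u) (hm : 0 < m)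
    (hum : u ≠ m) :
    (∑ i ∈ Finset.range m, t ^ q ^ i) * (∑ i ∈ Finset.range u, t ^ q ^ i) *
        ((∑ i ∈ Finset.range m, t⁻¹ ^ q ^ i) - ∑ i ∈ Finset.range u, t⁻¹ ^ q ^ i) ≠
      t ^ 2 * (∑ i ∈ Finset.range m, t⁻¹ ^ q ^ i) * (∑ i ∈ Finset.range u, t⁻¹ ^ q ^ i) *
        ((∑ i ∈ Finset.range u, t ^ q ^ i) - ∑ i ∈ Finset.range m, t ^ q ^ i) := by
  rcases lt_or_gt_of_ne hum with h | h
  · exact truncated_trace_ne_of_lt ht hq hu h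
  · intro e
    refine truncated_trace_ne_of_lt ht hq hm h ?_
    linear_combination -e

/-! ### The Frobenius determinant for the Segre functions `1, x, y, xy` -/

/-- Translating `(x, y)` to the origin is a unimodular column operation that turns the last two rows
into `(1, 0, 0, 0)` and `(0, x', y', 0)`; hence only differences occur. -/
theorem det_segre {R : Type*} [CommRing R] (X₁ Y₁ X₂ Y₂ x y x' y' : R) :
    (Matrix.of ![![1, X₁, Y₁, X₁ * Y₁], ![1, X₂, Y₂, X₂ * Y₂], ![1, x, y, x * y],
      ![0, x', y', x * y' + y * x']]).det =
    (X₁ - x) * (X₂ - x) * ((Y₁ - y) - (Y₂ - y)) * y' +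
      (Y₁ - y) * (Y₂ - y) * ((X₂ - x) - (X₁ - x)) * x' := by
  simp [Matrix.det_succ_row_zero, Fin.sum_univ_succ, Fin.succAbove]
  ring

/-- The `q ^ n`-Frobenius as an algebra homomorphism. -/
theorem exists_algHom_pow_card_pow (F K : Type*) [Field F] [Fintype F] [Field K] [Algebra F K]
    (n : ℕ) : ∃ φ : K →ₐ[F] K, ∀ a, φ a = a ^ Fintype.card F ^ n :=
  ⟨FiniteField.frobeniusAlgHom F K ^ n, fun a => by
    rw [AlgHom.coe_pow, FiniteField.coe_frobeniusAlgHom, pow_iterate]⟩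

/-- Frobenius is additive, so the sum telescopes. -/
theorem pow_card_pow_sub_self (F : Type*) {K : Type*} [Field F] [Fintype F] [Field K] [Algebra F K]
    (a : K) (n : ℕ) : a ^ Fintype.card F ^ n - a =
      ∑ i ∈ Finset.range n, (a ^ Fintype.card F - a) ^ Fintype.card F ^ i := by
  have h : ∀ i, (a ^ Fintype.card F - a) ^ Fintype.card F ^ i =
      a ^ Fintype.card F ^ (i + 1) - a ^ Fintype.card F ^ i := by
    intro i
    obtain ⟨φ, hφ⟩ := exists_algHom_pow_card_pow F K i
    rw [← hφ, map_sub, hφ, hφ, ← pow_mul, ← pow_succ']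
  simp only [h]
  rw [Finset.sum_range_sub (fun i => a ^ Fintype.card F ^ i)]
  simp

theorem derivation_pow_card {F K : Type*} [Field F] [Fintype F] [Field K] [Algebra F K]
    (D : Derivation F K K) (a : K) : D (a ^ Fintype.card F) = 0 := by
  have : (Fintype.card F : K) = 0 := by
    rw [← map_natCast (algebraMap F K), FiniteField.cast_card_eq_zero, map_zero]
  rw [D.leibniz_pow, ← Nat.cast_smul_eq_nsmul K, this, zero_smul]

/-! ### The function field of the generalized Artin-Mumford curve -/

section FunctionField

variable (F : Type*) [Field F] [Fintype F]

local notation "𝓚" => PlaneFunctionField (artinMumford F)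
local notation "𝔁" => xFun (artinMumford F)
local notation "𝔂" => yFun (artinMumford F)

theorem artinMumford_relation :
    (𝔁 ^ Fintype.card F - 𝔁) * (𝔂 ^ Fintype.card F - 𝔂) = 1 := by
  have h : AdjoinRoot.mk (artinMumford F)
      (C (X ^ Fintype.card F - X) * (X ^ Fintype.card F - X) - 1) = 0 := AdjoinRoot.mk_self
  have h2 := congrArg (algebraMap (AdjoinRoot (artinMumford F)) 𝓚) h
  simp only [map_sub, map_mul, map_pow, map_one, map_zero, AdjoinRoot.mk_C, AdjoinRoot.mk_X] at h2
  exact sub_eq_zero.1 h2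

theorem natDegree_artinMumford : (artinMumford F).natDegree = Fintype.card F := by
  have h1 : (X ^ Fintype.card F - X : F[X]) ≠ 0 :=
    FiniteField.X_pow_card_sub_X_ne_zero F Fintype.one_lt_card
  obtain ⟨k, hk⟩ : ∃ k, Fintype.card F = k + 2 :=
    ⟨Fintype.card F - 2, by have := Fintype.one_lt_card (α := F); omega⟩
  have h3 : (C (X ^ Fintype.card F - X) * (X ^ Fintype.card F - X) : F[X][X]).natDegree =
      Fintype.card F := by
    rw [natDegree_C_mul h1, hk]
    compute_degree!
  rw [artinMumford, natDegree_sub_eq_left_of_natDegree_lt, h3]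
  rw [h3, natDegree_one]
  omega

theorem transcendental_xFun : Transcendental F 𝔁 := by
  have hinj : Function.Injective (AdjoinRoot.of (artinMumford F)) := by
    refine AdjoinRoot.of.injective_of_degree_ne_zero ?_
    rw [degree_eq_natDegree (irreducible_artinMumford F).ne_zero, natDegree_artinMumford]
    exact_mod_cast Fintype.card_ne_zero
  have hinj2 := (IsFractionRing.injective (AdjoinRoot (artinMumford F)) 𝓚).comp hinj
  rw [transcendental_iff_injective]
  intro p r hpr
  refine hinj2 ?_
  have key : ∀ p : F[X], aeval 𝔁 p =
      algebraMap (AdjoinRoot (artinMumford F)) 𝓚 (AdjoinRoot.of (artinMumford F) p) := by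
    intro p
    let ρ : F[X] →ₐ[F] 𝓚 :=
      { (algebraMap (AdjoinRoot (artinMumford F)) 𝓚).comp (AdjoinRoot.of (artinMumford F)) with
        commutes' := fun c => rfl }
    have : aeval 𝔁 = ρ := by
      ext
      rw [aeval_X]
      rfl
    rw [this]; rfl
  simpa only [key, Function.comp_apply] using hpr

theorem adjoin_xFun_yFun : IntermediateField.adjoin F {𝔁, 𝔂} = ⊤ := by
  rw [eq_top_iff]
  rintro z -
  have hx : 𝔁 ∈ IntermediateField.adjoin F {𝔁, 𝔂} :=
    IntermediateField.subset_adjoin _ _ (by simp)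
  have hy : 𝔂 ∈ IntermediateField.adjoin F {𝔁, 𝔂} :=
    IntermediateField.subset_adjoin _ _ (by simp)
  have hC : ∀ p : F[X], algebraMap (AdjoinRoot (artinMumford F)) 𝓚
      (AdjoinRoot.of (artinMumford F) p) ∈ IntermediateField.adjoin F {𝔁, 𝔂} := by
    intro p
    induction p using Polynomial.induction_on' with
    | add p r hp hr => simpa only [map_add] using add_mem hp hr
    | monomial n a =>
      rw [← C_mul_X_pow_eq_monomial, map_mul, map_mul, map_pow, map_pow]
      exact mul_mem (IntermediateField.algebraMap_mem _ a) (pow_mem hx n)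
  have hA : ∀ a : AdjoinRoot (artinMumford F),
      algebraMap _ 𝓚 a ∈ IntermediateField.adjoin F {𝔁, 𝔂} := by
    intro a
    obtain ⟨p, rfl⟩ := AdjoinRoot.mk_surjective a
    induction p using Polynomial.induction_on' with
    | add p r hp hr => simpa only [map_add] using add_mem hp hr
    | monomial n a =>
      rw [← C_mul_X_pow_eq_monomial, map_mul, map_mul, map_pow, map_pow, AdjoinRoot.mk_C,
        AdjoinRoot.mk_X]
      exact mul_mem (hC a) (pow_mem hy n)
  obtain ⟨a, b, -, rfl⟩ := IsFractionRing.div_surjective (A := AdjoinRoot (artinMumford F)) z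
  exact div_mem (hA a) (hA b)

/-- Over `F(x)`, `y` is a root of `T^q - T - 1/(x^q - x)`, whose derivative is `-1`. -/
theorem isSeparatingVariable_xFun : IsSeparatingVariable F 𝔁 := by
  set E := IntermediateField.adjoin F {𝔁}
  have hx : 𝔁 ∈ E := IntermediateField.mem_adjoin_simple_self F _
  have hrel := artinMumford_relation F
  have hq : (Fintype.card F : E) = 0 := by
    rw [← map_natCast (algebraMap F E), FiniteField.cast_card_eq_zero, map_zero]
  let s : E := (⟨𝔁, hx⟩ ^ Fintype.card F - ⟨𝔁, hx⟩)⁻¹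
  have hs : algebraMap E 𝓚 s = 𝔂 ^ Fintype.card F - 𝔂 := by
    rw [eq_inv_of_mul_eq_one_right hrel, map_inv₀, map_sub, map_pow]
    rfl
  have hsep : IsSeparable E 𝔂 := by
    have h1 : (X ^ Fintype.card F - X - C s : E[X]).Separable := by
      rw [separable_def]
      refine ⟨0, -1, ?_⟩
      rw [derivative_sub, derivative_sub, derivative_X_pow, derivative_X, derivative_C, hq]
      simp only [map_zero]
      ring
    refine h1.of_dvd (minpoly.dvd _ _ ?_)
    simp [hs]
  have htop : IntermediateField.adjoin E {𝔂} = ⊤ := by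
    have h := adjoin_xFun_yFun F
    rw [Set.insert_eq, ← IntermediateField.adjoin_adjoin_left] at h
    simpa using h
  have h2 := (IntermediateField.isSeparable_adjoin_simple_iff_isSeparable E 𝓚).2 hsep
  rw [htop] at h2
  exact AlgEquiv.Algebra.isSeparable (IntermediateField.topEquiv (F := E) (E := 𝓚))

variable {F}

/-- Otherwise the whole function field would be algebraic over `F`, yet it contains the
transcendental `x`. -/
theorem IsSeparatingVariable.transcendental {τ : 𝓚} (hτ : IsSeparatingVariable F τ) :
    Transcendental F τ := by
  intro halg
  have : Algebra.IsSeparable (IntermediateField.adjoin F {τ}) 𝓚 := hτ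
  have := IntermediateField.isAlgebraic_adjoin_simple halg.isIntegral
  have : Algebra.IsAlgebraic F 𝓚 :=
    Algebra.IsAlgebraic.trans F (IntermediateField.adjoin F {τ}) 𝓚
  exact transcendental_xFun F (Algebra.IsAlgebraic.isAlgebraic _)

theorem derivation_ext_xFun_yFun (D : Derivation F 𝓚 𝓚) (hx : D 𝔁 = 0) (hy : D 𝔂 = 0) (z : 𝓚) :
    D z = 0 := by
  have hz : z ∈ IntermediateField.adjoin F {𝔁, 𝔂} := by rw [adjoin_xFun_yFun]; trivial
  induction hz using IntermediateField.adjoin_induction with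
  | mem w hw => rcases hw with rfl | rfl <;> assumption
  | algebraMap c => exact D.map_algebraMap c
  | add a b _ _ ha hb => rw [map_add, ha, hb, add_zero]
  | inv a _ ha => rw [D.leibniz_inv, ha, smul_zero]
  | mul a b _ _ ha hb => rw [D.leibniz, ha, hb, smul_zero, smul_zero, add_zero]

theorem det_frobeniusMatrix_segre_ne_zero {u m : ℕ} (hu : 0 < u) (hm : 0 < m) (hum : u ≠ m)
    {τ : 𝓚} (hτ : IsSeparatingVariable F τ) :
    (frobeniusMatrix F u m τ ![1, 𝔁, 𝔂, 𝔁 * 𝔂] (fun i : Fin 2 => (i : ℕ))).det ≠ 0 := by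
  have hH := isHasseFamily_hasseDerivative hτ hτ.transcendental
  set D := hH.derivation with hD
  have hD1 : ∀ a, hasseDerivative F τ 1 a = D a := fun a => rfl
  have hrel := artinMumford_relation F
  set q := Fintype.card F with hq
  set t := 𝔁 ^ q - 𝔁 with ht
  have ht0 : t ≠ 0 := left_ne_zero_of_mul_eq_one hrel
  have hs : 𝔂 ^ q - 𝔂 = t⁻¹ := eq_inv_of_mul_eq_one_right hrel
  have hdiff : D 𝔁 = -(t ^ 2 * D 𝔂) := by
    have h := congrArg D hrel
    rw [D.leibniz, map_sub, map_sub, derivation_pow_card, derivation_pow_card, D.map_one_eq_zero,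
      hs, smul_eq_mul, smul_eq_mul] at h
    field_simp at h
    linear_combination -h
  -- If `Dy = 0` then `Dx = 0`, so `D` kills `F(x, y)`, contradicting `Dτ = 1`.
  have hDy : D 𝔂 ≠ 0 := by
    intro h
    have h1 := derivation_ext_xFun_yFun D (by rw [hdiff, h, mul_zero, neg_zero]) h τ
    rw [hH.derivation_self] at h1
    exact one_ne_zero h1
  have htr : Transcendental F t := by
    have : t = aeval 𝔁 (X ^ q - X : F[X]) := by simp [ht]
    rw [this]
    refine transcendental_aeval_iff.2 ⟨transcendental_xFun F, ?_⟩
    have hdeg : (X ^ q - X : F[X]).natDegree = q :=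
      FiniteField.X_pow_card_sub_X_natDegree_eq F Fintype.one_lt_card
    refine Polynomial.transcendental _ (by rw [hdeg]; exact Fintype.card_ne_zero) ?_
    rw [mem_nonZeroDivisors_iff_ne_zero, leadingCoeff_ne_zero]
    exact FiniteField.X_pow_card_sub_X_ne_zero F Fintype.one_lt_card
  have hmat : frobeniusMatrix F u m τ ![1, 𝔁, 𝔂, 𝔁 * 𝔂] (fun i : Fin 2 => (i : ℕ)) =
      Matrix.of ![![1, 𝔁 ^ q ^ m, 𝔂 ^ q ^ m, 𝔁 ^ q ^ m * 𝔂 ^ q ^ m],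
        ![1, 𝔁 ^ q ^ u, 𝔂 ^ q ^ u, 𝔁 ^ q ^ u * 𝔂 ^ q ^ u], ![1, 𝔁, 𝔂, 𝔁 * 𝔂],
        ![0, D 𝔁, D 𝔂, 𝔁 * D 𝔂 + 𝔂 * D 𝔁]] := by
    ext i j
    fin_cases i <;> fin_cases j <;>
      simp [frobeniusMatrix, mul_pow, hH.zero_apply, hD1, ← hq]
  rw [hmat, det_segre, hdiff]
  intro h0
  refine truncated_trace_ne htr (Fintype.one_lt_card : 1 < q) hu hm hum ?_
  rw [← hs]
  simp only [ht, hq, ← pow_card_pow_sub_self]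
  refine mul_right_cancel₀ hDy ?_
  linear_combination h0

end FunctionField

/-! ### The functions cut out by the conics through `(1 : 0 : 0)` and `(0 : 1 : 0)` -/

section Conics

variable {F : Type*} [Field F]

theorem sum_exponents_eq_of_isHomogeneous {H : MvPolynomial (Fin 3) F} {n : ℕ}
    (hom : H.IsHomogeneous n) {d : Fin 3 →₀ ℕ} (hd : H.coeff d ≠ 0) : d 0 + d 1 + d 2 = n := by
  have h := hom hd
  have hw : Finsupp.weight 1 d = d.degree := (DFunLike.congr_fun Finsupp.degree_eq_weight_one d).symm
  rwa [hw, Finsupp.degree_eq_sum, Fin.sum_univ_three] at h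

/-- At `(1, 0, 0)` every quadratic monomial other than `X²` vanishes, so the value there is the
coefficient of `X²`; likewise `Y²` at `(0, 1, 0)`. -/
theorem coeff_eq_zero_of_mem_conicsThrough {H : MvPolynomial (Fin 3) F}
    (hH : H ∈ conicsThrough F ![1, 0, 0] ![0, 1, 0]) :
    H.coeff (Finsupp.single 0 2) = 0 ∧ H.coeff (Finsupp.single 1 2) = 0 := by
  obtain ⟨hom, h0, h1⟩ := hH
  have hom' : H.IsHomogeneous 2 := hom
  have h0' : MvPolynomial.aeval ![(1 : F), 0, 0] H = 0 := h0
  have h1' : MvPolynomial.aeval ![(0 : F), 1, 0] H = 0 := h1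
  rw [MvPolynomial.aeval_def, MvPolynomial.eval₂_eq'] at h0' h1'
  have hdeg : ∀ d ∈ H.support, d 0 + d 1 + d 2 = 2 := fun d hd =>
    sum_exponents_eq_of_isHomogeneous hom' (MvPolynomial.mem_support_iff.1 hd)
  constructor
  · rw [Finset.sum_eq_single (Finsupp.single 0 2)] at h0'
    · simpa [Fin.prod_univ_three] using h0'
    · intro d hd hne
      by_cases h : d 1 = 0 ∧ d 2 = 0
      · refine absurd ?_ hne
        have := hdeg d hd
        ext i
        fin_cases i <;> simp [h.1, h.2]
        omega
      · simp only [Fin.prod_univ_three]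
        rcases not_and_or.1 h with h | h <;> simp [h]
    · intro h
      simp [MvPolynomial.notMem_support_iff.1 h]
  · rw [Finset.sum_eq_single (Finsupp.single 1 2)] at h1'
    · simpa [Fin.prod_univ_three] using h1'
    · intro d hd hne
      by_cases h : d 0 = 0 ∧ d 2 = 0
      · refine absurd ?_ hne
        have := hdeg d hd
        ext i
        fin_cases i <;> simp [h.1, h.2]
        omega
      · simp only [Fin.prod_univ_three]
        rcases not_and_or.1 h with h | h <;> simp [h]
    · intro h
      simp [MvPolynomial.notMem_support_iff.1 h]

theorem seriesFunctions_conicsThrough (f : F[X][X]) [IsDomain (AdjoinRoot f)] :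
    seriesFunctions f (conicsThrough F ![1, 0, 0] ![0, 1, 0]) =
      Submodule.span F (Set.range ![1, xFun f, yFun f, xFun f * yFun f]) := by
  apply le_antisymm
  · rintro _ ⟨H, hH, rfl⟩
    obtain ⟨c0, c1⟩ := coeff_eq_zero_of_mem_conicsThrough hH
    have hom : H.IsHomogeneous 2 := hH.1
    change MvPolynomial.aeval ![xFun f, yFun f, 1] H ∈ _
    rw [MvPolynomial.aeval_def, MvPolynomial.eval₂_eq']
    refine Submodule.sum_mem _ fun d hd => ?_
    have hc := MvPolynomial.mem_support_iff.1 hd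
    have hdeg : d 0 + d 1 + d 2 = 2 := sum_exponents_eq_of_isHomogeneous hom hc
    rw [← Algebra.smul_def]
    refine Submodule.smul_mem _ _ ?_
    have h0 : d ≠ Finsupp.single 0 2 := fun h => hc (h ▸ c0)
    have h1 : d ≠ Finsupp.single 1 2 := fun h => hc (h ▸ c1)
    have hd0 : d 0 < 2 := by
      by_contra h
      refine h0 (Finsupp.ext fun i => ?_)
      fin_cases i <;> simp <;> omega
    have hd1 : d 1 < 2 := by
      by_contra h
      refine h1 (Finsupp.ext fun i => ?_)
      fin_cases i <;> simp <;> omega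
    simp only [Fin.prod_univ_three]
    generalize d 0 = a at *
    generalize d 1 = b at *
    have hmem := Submodule.subset_span (R := F)
      (s := Set.range ![1, xFun f, yFun f, xFun f * yFun f])
    interval_cases a <;> interval_cases b
    · exact hmem ⟨0, by simp⟩
    · exact hmem ⟨2, by simp⟩
    · exact hmem ⟨1, by simp⟩
    · exact hmem ⟨3, by simp⟩
  · rw [Submodule.span_le]
    rintro _ ⟨i, rfl⟩
    have hX : ∀ j k : Fin 3, (MvPolynomial.X j * MvPolynomial.X k :
        MvPolynomial (Fin 3) F).IsHomogeneous 2 := fun j k =>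
      (MvPolynomial.isHomogeneous_X F j).mul (MvPolynomial.isHomogeneous_X F k)
    have key : ∀ j k : Fin 3, (j, k) ≠ (0, 0) → (j, k) ≠ (1, 1) →
        ![xFun f, yFun f, 1] j * ![xFun f, yFun f, 1] k ∈
          seriesFunctions f (conicsThrough F ![1, 0, 0] ![0, 1, 0]) := by
      intro j k h0 h1
      refine ⟨MvPolynomial.X j * MvPolynomial.X k, ⟨hX j k, ?_, ?_⟩, ?_⟩
      · change MvPolynomial.aeval ![(1 : F), 0, 0] _ = 0
        fin_cases j <;> fin_cases k <;> simp at *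
      · change MvPolynomial.aeval ![(0 : F), 1, 0] _ = 0
        fin_cases j <;> fin_cases k <;> simp at *
      · change MvPolynomial.aeval ![xFun f, yFun f, 1] _ = _
        simp
    fin_cases i
    · simpa using key 2 2 (by decide) (by decide)
    · simpa using key 0 2 (by decide) (by decide)
    · simpa using key 1 2 (by decide) (by decide)
    · simpa using key 0 1 (by decide) (by decide)

end Conics

/-! ### Change of basis -/

section ChangeOfBasis

variable {F K : Type*} [Field F] [Fintype F] [Field K] [Algebra F K]

/-- The Frobenius matrix is `F`-linear in the functions. -/
theorem frobeniusMatrix_linearCombination (u m : ℕ) (τ : K) {n : ℕ} (f g : Fin (n + 2) → K)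
    (κ : Fin n → ℕ) (P : Matrix (Fin (n + 2)) (Fin (n + 2)) F)
    (h : ∀ j, g j = ∑ i, P i j • f i) :
    frobeniusMatrix F u m τ g κ =
      frobeniusMatrix F u m τ f κ * P.map (algebraMap F K) := by
  have hL : ∀ (L : K →ₗ[F] K) (j : Fin (n + 2)),
      L (g j) = ∑ i, L (f i) * algebraMap F K (P i j) := by
    intro L j
    rw [h, map_sum]
    refine Finset.sum_congr rfl fun i _ => ?_
    rw [map_smul, Algebra.smul_def, mul_comm]
  have hpow : ∀ (l : ℕ) (j : Fin (n + 2)), g j ^ Fintype.card F ^ l =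
      ∑ i, f i ^ Fintype.card F ^ l * algebraMap F K (P i j) := by
    intro l j
    obtain ⟨φ, hφ⟩ := exists_algHom_pow_card_pow F K l
    simpa only [AlgHom.toLinearMap_apply, hφ] using hL φ.toLinearMap j
  ext i j
  rw [Matrix.mul_apply]
  refine Fin.cases ?_ (fun i => Fin.cases ?_ (fun i => ?_) i) i
  · exact hpow m j
  · exact hpow u j
  · exact hL _ j

/-- Functions over which the Frobenius determinant does not vanish are linearly independent. -/
theorem linearIndependent_of_det_frobeniusMatrix_ne_zero {u m : ℕ} {τ : K} {n : ℕ}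
    {f : Fin (n + 2) → K} {κ : Fin n → ℕ} (h : (frobeniusMatrix F u m τ f κ).det ≠ 0) :
    LinearIndependent F f := by
  rw [Fintype.linearIndependent_iff]
  intro c hc
  -- The relation `c` is copied into every column of a square matrix, so that the
  -- change-of-functions formula applies with target `0`.
  have h1 := frobeniusMatrix_linearCombination u m τ f 0 κ (Matrix.of fun i _ => c i)
    (fun j => by simpa using hc.symm)
  have h2 : (frobeniusMatrix F u m τ (0 : Fin (n + 2) → K) κ) = 0 := by
    have := frobeniusMatrix_linearCombination u m τ f 0 κ (Matrix.of fun _ _ => (0 : F))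
      (fun j => by simp)
    rw [this]
    ext
    simp [Matrix.mul_apply]
  rw [h2] at h1
  have hu : IsUnit (frobeniusMatrix F u m τ f κ) :=
    (Matrix.isUnit_iff_isUnit_det _).2 (isUnit_iff_ne_zero.2 h)
  have h3 := (hu.mul_right_eq_zero).1 h1.symm
  intro i
  have h4 := congrFun (congrFun h3 i) 0
  simpa using h4

/-- If the Frobenius determinant of functions `f` in `V` is nonzero, then so is that of every basis
of `V`. -/
theorem det_frobeniusMatrix_ne_zero_of_basis {u m : ℕ} {τ : K} {n : ℕ}
    {f : Fin (n + 2) → K} {κ : Fin n → ℕ} {V : Submodule F K}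
    (h : (frobeniusMatrix F u m τ f κ).det ≠ 0) (hf : ∀ i, f i ∈ V)
    (b : Module.Basis (Fin (n + 2)) F V) :
    (frobeniusMatrix F u m τ (fun j => (b j : K)) κ).det ≠ 0 := by
  intro h0
  -- Expressing `f` in the basis makes its determinant a multiple of that of `b`; invertibility of
  -- the transition matrix is not needed.
  refine h ?_
  rw [frobeniusMatrix_linearCombination u m τ (fun j => (b j : K)) f κ
    (Matrix.of fun i j => b.repr ⟨f j, hf j⟩ i) (fun j => ?_), Matrix.det_mul, h0, zero_mul]
  have := congrArg V.subtype (b.sum_repr ⟨f j, hf j⟩)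
  rw [map_sum] at this
  exact this.symm

/-- If the Frobenius determinant of order `(0, 1)` does not vanish, then `(0, 1)` is the Frobenius
order sequence. -/
theorem isFrobeniusOrderSequence_zero_one {u m : ℕ} {τ : K} {f : Fin 4 → K}
    (h : (frobeniusMatrix F u m τ f (fun i : Fin 2 => (i : ℕ))).det ≠ 0) :
    IsFrobeniusOrderSequence F u m τ f (fun i : Fin 2 => (i : ℕ)) := by
  refine ⟨h, fun s hs => ?_⟩
  by_contra hlt
  rw [not_le] at hlt
  refine hs ?_
  obtain ⟨i, hi, hi2⟩ := hlt
  -- `(0, 0)` is the only pair lexicographically below `(0, 1)`.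
  have h01 : ofLex s 0 = 0 ∧ ofLex s 1 = 0 := by
    fin_cases i
    · exact absurd hi2 (Nat.not_lt_zero _)
    · exact ⟨hi 0 (by decide), Nat.lt_one_iff.1 hi2⟩
  refine Matrix.det_zero_of_row_eq (i := 2) (j := 3) (by decide) ?_
  funext j
  change hasseDerivative F τ (ofLex s 0) (f j) = hasseDerivative F τ (ofLex s 1) (f j)
  rw [h01.1, h01.2]

end ChangeOfBasis

end FrobeniusOrders

end

theorem corollary5p8 (F : Type*) [Field F] [Fintype F] (hp : 3 < ringChar F)
    (u m : ℕ) (hu : 0 < u) (hm : 0 < m) (hum : u ≠ m) (hgcd : Nat.gcd u m = 1) :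
    FrobeniusOrders.IsFrobeniusClassical F
      (FrobeniusOrders.seriesFunctions (FrobeniusOrders.artinMumford F)
        (FrobeniusOrders.conicsThrough F ![1, 0, 0] ![0, 1, 0])) u m := by
  have hdet := fun τ (hτ : FrobeniusOrders.IsSeparatingVariable F τ) =>
    FrobeniusOrders.det_frobeniusMatrix_segre_ne_zero (F := F) hu hm hum hτ
  rw [FrobeniusOrders.seriesFunctions_conicsThrough]
  refine ⟨2, ?_, ⟨_, FrobeniusOrders.isSeparatingVariable_xFun F⟩, fun b τ hτ => ?_⟩
  · have hli := FrobeniusOrders.linearIndependent_of_det_frobeniusMatrix_ne_zero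
      (hdet _ (FrobeniusOrders.isSeparatingVariable_xFun F))
    rw [finrank_span_eq_card hli, Fintype.card_fin]
  · exact FrobeniusOrders.isFrobeniusOrderSequence_zero_one
      (FrobeniusOrders.det_frobeniusMatrix_ne_zero_of_basis (hdet τ hτ)
        (fun i => Submodule.subset_span (Set.mem_range_self i)) b)
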